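/- Let $\mathbb X$ and $\mathbb Y$ be Euclidean spaces (finite-dimensional real Hilbert spaces), let $\varphi\colon\mathbb X\to\mathbb R$ be locally Lipschitz continuous, let $\Phi\colon\mathbb X\rightrightarrows\mathbb Y$ be a set-valued mapping with closed graph $\operatorname{gph}\Phi=\{(x,y)\mid y\in\Phi(x)\}$, and let $\bar y\in\mathbb Y$. Put $\Phi^{-1}(\bar y):=\{x\in\mathbb X\mid\bar y\in\Phi(x)\}$ and consider $$\min\{\varphi(x)\mid \bar y\in\Phi(x)\}.\tag{P}$$ Notation. Products carry the Euclidean (sum) inner product. For a closed set $Q$ in a Euclidean space and $x\in Q$, the regular normal cone is $$\widehat{\mathcal N}_Q(x):=\{\eta\mid\langle\eta,x'-x\rangle\le o(\|x'-x\|)\ \text{for } x'\in Q\},$$ and the limiting normal cone $\mathcal N_Q(x)$ consists of all limits $\eta$ of sequences $\eta_k\in\widehat{\mathcal N}_Q(x_k)$ with $x_k\in Q$ and $x_k\to x$; both cones are empty if $x\notin Q$. With $\operatorname{epi}\varphi=\{(x,\alpha)\in\mathbb X\times\mathbb R\mid\varphi(x)\le\alpha\}$, the regular (Fréchet) subdifferential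 is $\widehat\partial\varphi(x):=\{\eta\mid(\eta,-1)\in\widehat{\mathcal N}_{\operatorname{epi}\varphi}(x,\varphi(x))\}$, and the regular coderivative is $\widehat D^*\Phi(x,y)(y^*):=\{x^*\mid(x^*,-y^*)\in\widehat{\mathcal N}_{\operatorname{gph}\Phi}(x,y)\}$. The limiting objects $\partial\varphi$ and $D^*\Phi$ are defined in the same way with $\mathcal N$ in place of $\widehat{\mathcal N}$. A feasible point $\bar x$ of (P) is M-stationary if $0\in\partial\varphi(\bar x)+D^*\Phi(\bar x,\bar y)(\lambda)$ for some $\lambda\in\mathbb Y$. A direction $u\in\mathbb X$ with $\|u\|=1$ is critical for (P) at $\bar x$ if there are sequences $u_k\to u$, $v_k\to0$ and $t_k\to 0$ with $t_k>0$ such that $(\bar x+t_ku_k,\bar y+t_kv_k)\in\operatorname{gph}\Phi$ for all $k$ and $\limsup_{k\to\infty}\,(\varphi(\bar x+t_ku_k)-\varphi(\bar x))/t_k\le0$. Statement. Let $\bar x$ be a local minimizer of (P). Then $\bar x$ is M-stationary, or there exist a critical direction $u$ for (P) at $\bar x$ and $y^*\in\mathbb Y$ as well as sequences $(x_k),(x_k'),(\eta_k)\subset\mathbb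 X$ and $(y_k),(y_k^*)\subset\mathbb Y$ such that $x_k,x_k'\notin\Phi^{-1}(\bar y)$, $y_k\ne\bar y$ and $y_k^*\ne0$ for all $k$, such that $$x_k\to\bar x,\qquad x_k'\to\bar x,\qquad y_k\to\bar y,$$ $$\frac{x_k-\bar x}{\|x_k-\bar x\|}\to u,\qquad \frac{x_k'-\bar x}{\|x_k'-\bar x\|}\to u,\qquad \frac{y_k-\bar y}{\|x_k-\bar x\|}\to0,$$ $$y_k^*\to y^*,\qquad \frac{\|x_k-\bar x\|}{\|y_k-\bar y\|}\,\|y_k^*\|\to\infty,\qquad \eta_k\to0,$$ $$\frac{y_k-\bar y}{\|y_k-\bar y\|}-\frac{y_k^*}{\|y_k^*\|}\to0,$$ and such that $$\eta_k\in\widehat\partial\varphi(x_k')+\widehat D^*\Phi(x_k,y_k)\!\left(\frac{\|x_k-\bar x\|}{\|y_k-\bar y\|}\,y_k^*\right)\qquad\text{for all }k.$$ -/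

import Mathlib

open Filter Topology
open scoped Pointwise RealInnerProductSpace

namespace VarAnalysis

section NormalCones

variable {E : Type*} [NormedAddCommGroup E] [InnerProductSpace ℝ E]

/-- The regular (Fréchet) normal cone to `Q` at `x`: all `η` with
`⟪η, x' - x⟫ ≤ o(‖x' - x‖)` for `x' ∈ Q`. It is empty if `x ∉ Q`. -/
def regularNormalCone (Q : Set E) (x : E) : Set E :=
  {η | x ∈ Q ∧ ∀ ε : ℝ, 0 < ε → ∀ᶠ x' in 𝓝[Q] x, ⟪η, x' - x⟫ ≤ ε * ‖x' - x‖}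

/-- The limiting (Mordukhovich) normal cone to `Q` at `x`; it is empty if `x ∉ Q`. -/
def limitingNormalCone (Q : Set E) (x : E) : Set E :=
  {η | x ∈ Q ∧ ∃ (xs : ℕ → E) (ηs : ℕ → E),
    (∀ k, xs k ∈ Q) ∧ Tendsto xs atTop (𝓝 x) ∧ Tendsto ηs atTop (𝓝 η) ∧
    ∀ k, ηs k ∈ regularNormalCone Q (xs k)}

end NormalCones

section Maps

variable {X Y : Type*} [NormedAddCommGroup X] [InnerProductSpace ℝ X]
  [NormedAddCommGroup Y] [InnerProductSpace ℝ Y]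

/-- The epigraph of `φ`, as a subset of `X × ℝ` with its Euclidean (`ℓ²`) product structure. -/
def epi (φ : X → ℝ) : Set (WithLp 2 (X × ℝ)) :=
  {p | φ p.fst ≤ p.snd}

/-- The regular (Fréchet) subdifferential. -/
def regularSubdifferential (φ : X → ℝ) (x : X) : Set X :=
  {η | WithLp.toLp 2 (η, (-1 : ℝ)) ∈ regularNormalCone (epi φ) (WithLp.toLp 2 (x, φ x))}

/-- The limiting (Mordukhovich) subdifferential. -/
def limitingSubdifferential (φ : X → ℝ) (x : X) : Set X :=
  {η | WithLp.toLp 2 (η, (-1 : ℝ)) ∈ limitingNormalCone (epi φ) (WithLp.toLp 2 (x, φ x))}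

/-- The graph of a set-valued mapping `Φ : X ⇉ Y`, as a subset of `X × Y` with its
Euclidean (`ℓ²`) product structure. -/
def gph (Φ : X → Set Y) : Set (WithLp 2 (X × Y)) :=
  {p | p.snd ∈ Φ p.fst}

/-- The inverse `Φ⁻¹ : Y ⇉ X` of a set-valued mapping. -/
def inverseMap (Φ : X → Set Y) (y : Y) : Set X :=
  {x | y ∈ Φ x}

/-- The regular coderivative of `Φ` at `(x, y)`. -/
def regularCoderivative (Φ : X → Set Y) (x : X) (y : Y) (yStar : Y) : Set X :=
  {xStar | WithLp.toLp 2 (xStar, -yStar) ∈ regularNormalCone (gph Φ) (WithLp.toLp 2 (x, y))}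

/-- The limiting coderivative of `Φ` at `(x, y)`. -/
def limitingCoderivative (Φ : X → Set Y) (x : X) (y : Y) (yStar : Y) : Set X :=
  {xStar | WithLp.toLp 2 (xStar, -yStar) ∈ limitingNormalCone (gph Φ) (WithLp.toLp 2 (x, y))}

/-- Local minimizers of the problem `min {φ x | ybar ∈ Φ x}`. -/
def IsLocalMinimizer (φ : X → ℝ) (Φ : X → Set Y) (ybar : Y) (xbar : X) : Prop :=
  xbar ∈ inverseMap Φ ybar ∧ IsLocalMinOn φ (inverseMap Φ ybar) xbar

/-- M-stationarity of a feasible point of `min {φ x | ybar ∈ Φ x}`. -/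
def IsMStationary (φ : X → ℝ) (Φ : X → Set Y) (ybar : Y) (xbar : X) : Prop :=
  xbar ∈ inverseMap Φ ybar ∧
    ∃ lam : Y, (0 : X) ∈ limitingSubdifferential φ xbar + limitingCoderivative Φ xbar ybar lam

/-- Critical (unit) directions of `min {φ x | ybar ∈ Φ x}` at `xbar`. The upper limit is taken in
the extended reals. -/
def IsCriticalDirection (φ : X → ℝ) (Φ : X → Set Y) (ybar : Y) (xbar : X) (u : X) : Prop :=
  ‖u‖ = 1 ∧ ∃ (us : ℕ → X) (vs : ℕ → Y) (ts : ℕ → ℝ),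
    Tendsto us atTop (𝓝 u) ∧ Tendsto vs atTop (𝓝 0) ∧
    (∀ k, 0 < ts k) ∧ Tendsto ts atTop (𝓝 0) ∧
    (∀ k, WithLp.toLp 2 (xbar + ts k • us k, ybar + ts k • vs k) ∈ gph Φ) ∧
    limsup (fun k => (((φ (xbar + ts k • us k) - φ xbar) / ts k : ℝ) : EReal)) atTop ≤ 0

end Maps

end VarAnalysis

namespace VarAnalysis

/-! ### Quadratic estimates for regular normals. -/

section Proximal

variable {E : Type*} [NormedAddCommGroup E] [InnerProductSpace ℝ E]

/-! The problem is penalized with split variables: `φ x' + ‖x - xbar‖² / 2 + κ ‖y - ybar‖² / 2 + c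
‖x' - x‖² / 2` is minimized over small balls subject to `y ∈ Φ x`. Only smooth terms couple `φ` with
the graph, so Fermat's rule gives exact regular stationarity with residual `-(x - xbar)` and
multiplier `κ • (y - ybar)`. Letting `c → ∞` merges `x'` and `x`; large `κ` forces `(x, y)` close to
`(xbar, ybar)` (`exists_penalty_forall_near`).

If the multipliers are bounded along a subsequence, the limit is M-stationary
(`isMStationary_of_penaltyStationary`). Otherwise they diverge in norm. Comparison with `(xbar,
ybar)` and the Lipschitz bound give `κ ‖y - ybar‖² ≤ (2L + 1) ‖x - xbar‖`. This bounds the rescaled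
multipliers and, divided by `κ ‖y - ybar‖ → ∞`, makes `‖y - ybar‖ / ‖x - xbar‖` vanish.
`exists_penaltyStationary` supplies this dichotomy. -/

/-- Proximal normals are regular normals. -/
theorem mem_regularNormalCone_of_quadratic {Q : Set E} {x η : E} (hx : x ∈ Q) {C : ℝ}
    (h : ∀ᶠ z in 𝓝[Q] x, ⟪η, z - x⟫ ≤ C * ‖z - x‖ ^ 2) : η ∈ regularNormalCone Q x := by
  refine ⟨hx, fun ε hε => ?_⟩
  have hsmall : ∀ᶠ z in 𝓝 x, C * ‖z - x‖ < ε := by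
    have hc : Continuous fun z : E => C * ‖z - x‖ := by fun_prop
    exact hc.continuousAt.eventually_lt_const (by simpa using hε)
  filter_upwards [h, hsmall.filter_mono nhdsWithin_le_nhds] with z h1 h2
  nlinarith [norm_nonneg (z - x)]

/-- The second-order expansion of the squared distance to a point. -/
theorem norm_sub_sq_expand (z x a : E) :
    ‖z - a‖ ^ 2 = ‖x - a‖ ^ 2 + 2 * ⟪x - a, z - x⟫ + ‖z - x‖ ^ 2 := by
  rw [← norm_add_sq_real]
  congr 2
  abel

end Proximal

/-! ### Fermat rules and penalized problems. -/

section Penalization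

variable {X Y : Type*} [NormedAddCommGroup X] [InnerProductSpace ℝ X]
  [NormedAddCommGroup Y] [InnerProductSpace ℝ Y]

theorem inner_toLp_sub (a c : X) (b d : Y) (p : WithLp 2 (X × Y)) :
    ⟪WithLp.toLp 2 (a, b), p - WithLp.toLp 2 (c, d)⟫ = ⟪a, p.fst - c⟫ + ⟪b, p.snd - d⟫ :=
  WithLp.prod_inner_apply _ _

theorem norm_sub_toLp_sq {X Y : Type*} [NormedAddCommGroup X] [NormedAddCommGroup Y] (c : X)
    (d : Y) (p : WithLp 2 (X × Y)) :
    ‖p - WithLp.toLp 2 (c, d)‖ ^ 2 = ‖p.fst - c‖ ^ 2 + ‖p.snd - d‖ ^ 2 :=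
  WithLp.prod_norm_sq_eq_of_L2 _

/-- Fermat's rule for the sum of a function and a quadratic. -/
theorem mem_regularSubdifferential_of_isLocalMin {φ : X → ℝ} {x a : X} {c : ℝ} (hc : 0 ≤ c)
    (h : IsLocalMin (fun z => φ z + c / 2 * ‖z - a‖ ^ 2) x) :
    -(c • (x - a)) ∈ regularSubdifferential φ x := by
  refine mem_regularNormalCone_of_quadratic (C := c / 2) (le_refl (φ x)) ?_
  have hfst : Tendsto (fun p : WithLp 2 (X × ℝ) => p.fst) (𝓝 (WithLp.toLp 2 (x, φ x))) (𝓝 x) :=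
    (WithLp.continuous_fst (p := 2) (α := X) (β := ℝ)).tendsto _
  filter_upwards [(hfst.eventually h).filter_mono nhdsWithin_le_nhds,
    self_mem_nhdsWithin] with p hp hpQ
  have hpQ : φ p.fst ≤ p.snd := hpQ
  -- The linear term of this expansion yields the normal; the second-order term is the admissible
  -- quadratic error.
  have hexp := norm_sub_sq_expand p.fst x a
  have hone : ⟪(-1 : ℝ), p.snd - φ x⟫ = -(p.snd - φ x) := by simp
  rw [inner_toLp_sub, norm_sub_toLp_sq, inner_neg_left, real_inner_smul_left, hone]
  have : 0 ≤ c / 2 * ‖p.snd - φ x‖ ^ 2 := by positivity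
  nlinarith

/-- Fermat's rule for the sum of two quadratics and a penalty term over the graph of a set-valued
mapping. -/
theorem mem_regularCoderivative_of_isLocalMinOn {Φ : X → Set Y} {x a b : X} {y yb : Y}
    {c κ : ℝ} (hc : 0 ≤ c) (hκ : 0 ≤ κ) (hy : y ∈ Φ x)
    (h : ∀ᶠ p in 𝓝 (x, y), p.2 ∈ Φ p.1 →
      1 / 2 * ‖x - b‖ ^ 2 + κ / 2 * ‖y - yb‖ ^ 2 + c / 2 * ‖x - a‖ ^ 2 ≤
      1 / 2 * ‖p.1 - b‖ ^ 2 + κ / 2 * ‖p.2 - yb‖ ^ 2 + c / 2 * ‖p.1 - a‖ ^ 2) :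
    -(x - b) - c • (x - a) ∈ regularCoderivative Φ x y (κ • (y - yb)) := by
  refine mem_regularNormalCone_of_quadratic (C := 1 / 2 + κ / 2 + c / 2) hy ?_
  have hof : Tendsto (fun p : WithLp 2 (X × Y) => (p.fst, p.snd))
      (𝓝 (WithLp.toLp 2 (x, y))) (𝓝 (x, y)) :=
    ((WithLp.continuous_fst (p := 2) (α := X) (β := Y)).prodMk
      (WithLp.continuous_snd (p := 2) (α := X) (β := Y))).tendsto (WithLp.toLp 2 (x, y))
  filter_upwards [(hof.eventually h).filter_mono nhdsWithin_le_nhds,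
    self_mem_nhdsWithin] with p hp hpQ
  have hp := hp hpQ
  rw [norm_sub_sq_expand p.fst x a, norm_sub_sq_expand p.fst x b,
    norm_sub_sq_expand p.snd y yb] at hp
  rw [inner_toLp_sub, norm_sub_toLp_sq, inner_neg_left, real_inner_smul_left, inner_sub_left,
    inner_neg_left, real_inner_smul_left]
  have h1 : 0 ≤ ‖p.fst - x‖ ^ 2 := by positivity
  have h2 : 0 ≤ ‖p.snd - y‖ ^ 2 := by positivity
  nlinarith [mul_nonneg hκ h1, mul_nonneg hc h2]

/-- Approximate stationarity with the multiplier `κ • (y - ybar)` and a subgradient of norm at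
most `R`; the residual is `-(x - xbar)`. The point is the triple `(x', x, y)`. -/
def PenaltyStationary (φ : X → ℝ) (Φ : X → Set Y) (xbar : X) (ybar : Y) (κ R : ℝ)
    (p : X × X × Y) : Prop :=
  p.2.2 ∈ Φ p.2.1 ∧ ∃ ξ ∈ regularSubdifferential φ p.1, ‖ξ‖ ≤ R ∧
    -(p.2.1 - xbar) - ξ ∈ regularCoderivative Φ p.2.1 p.2.2 (κ • (p.2.2 - ybar))

/-! ### Compactness arguments for the penalized problems. -/

variable [FiniteDimensional ℝ X] [FiniteDimensional ℝ Y]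

/-- For a sufficiently large penalty parameter, sublevel points of the penalized problem are close
to a local minimizer. -/
theorem exists_penalty_forall_near {φ : X → ℝ} (hφ : Continuous φ) {Φ : X → Set Y}
    (hΦ : IsClosed {p : X × Y | p.2 ∈ Φ p.1}) {xbar : X} {ybar : Y} {r : ℝ}
    (hmin : ∀ z ∈ Metric.closedBall xbar r, ybar ∈ Φ z → φ xbar ≤ φ z) {ε : ℝ} (hε : 0 < ε) :
    ∃ κ : ℝ, 0 < κ ∧ ∀ x ∈ Metric.closedBall xbar r, ∀ y ∈ Metric.closedBall ybar r, y ∈ Φ x →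
      φ x + 1 / 2 * ‖x - xbar‖ ^ 2 + κ / 2 * ‖y - ybar‖ ^ 2 ≤ φ xbar →
      ‖x - xbar‖ < ε ∧ ‖y - ybar‖ < ε := by
  by_contra! hcon
  choose x hx y hy hyx hle hfar using fun n : ℕ => hcon (n + 1) (by positivity)
  obtain ⟨⟨x₀, y₀⟩, -, s, hs, hlim⟩ :=
    ((isCompact_closedBall xbar r).prod (isCompact_closedBall ybar r)).tendsto_subseq
      (x := fun n => (x n, y n)) (fun n => ⟨hx n, hy n⟩)
  have hxl : Tendsto (x ∘ s) atTop (𝓝 x₀) := (continuous_fst.tendsto _).comp hlim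
  have hyl : Tendsto (y ∘ s) atTop (𝓝 y₀) := (continuous_snd.tendsto _).comp hlim
  have hgr : y₀ ∈ Φ x₀ := hΦ.mem_of_tendsto hlim (Eventually.of_forall fun n => hyx (s n))
  obtain ⟨B, hB⟩ := ((isCompact_closedBall xbar r).image hφ).bddBelow
  have hBx : ∀ n, B ≤ φ (x n) := fun n => hB ⟨x n, hx n, rfl⟩
  -- With `φ ≥ B` on the ball, the penalty term is at most `φ xbar - B` while its weight tends to
  -- infinity.
  have hy0 : y₀ = ybar := by
    have hup : Tendsto (fun n => 2 * (φ xbar - B) * (1 / ((s n : ℝ) + 1))) atTop (𝓝 0) := by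
      simpa using (tendsto_one_div_add_atTop_nhds_zero_nat.comp hs.tendsto_atTop).const_mul
        (2 * (φ xbar - B))
    have hsq : Tendsto (fun n => ‖y (s n) - ybar‖ ^ 2) atTop (𝓝 0) := by
      refine squeeze_zero (fun n => by positivity) (fun n => ?_) hup
      rw [mul_one_div, le_div_iff₀ (by positivity)]
      nlinarith [hle (s n), hBx (s n), sq_nonneg ‖x (s n) - xbar‖]
    have hsq' : Tendsto (fun n => ‖y (s n) - ybar‖ ^ 2) atTop (𝓝 (‖y₀ - ybar‖ ^ 2)) :=
      ((hyl.sub_const ybar).norm).pow 2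
    have := tendsto_nhds_unique hsq' hsq
    simpa [sub_eq_zero] using this
  have hx0mem : x₀ ∈ Metric.closedBall xbar r :=
    Metric.isClosed_closedBall.mem_of_tendsto hxl (Eventually.of_forall fun n => hx (s n))
  -- The limit is feasible, and the term `‖x - xbar‖² / 2` turns `xbar` into a strict minimizer.
  have hx0 : x₀ = xbar := by
    have h1 : φ x₀ + 1 / 2 * ‖x₀ - xbar‖ ^ 2 ≤ φ xbar := by
      refine le_of_tendsto (((hφ.tendsto x₀).comp hxl).add
        ((((hxl.sub_const xbar).norm).pow 2).const_mul (1 / 2)))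
        (Eventually.of_forall fun n => ?_)
      have : 0 ≤ (((s n : ℕ) : ℝ) + 1) / 2 * ‖y (s n) - ybar‖ ^ 2 := by positivity
      simp only [Function.comp_apply]
      linarith [hle (s n)]
    have h2 := hmin x₀ hx0mem (hy0 ▸ hgr)
    have h3 : ‖x₀ - xbar‖ ^ 2 = 0 := le_antisymm (by linarith) (by positivity)
    simpa [sub_eq_zero] using h3
  have hxn : ∀ᶠ n in atTop, ‖x (s n) - xbar‖ < ε :=
    ((hxl.sub_const xbar).norm).eventually_lt_const (by simpa [hx0] using hε)
  have hyn : ∀ᶠ n in atTop, ‖y (s n) - ybar‖ < ε :=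
    ((hyl.sub_const ybar).norm).eventually_lt_const (by simpa [hy0] using hε)
  obtain ⟨n, h1, h2⟩ := (hxn.and hyn).exists
  exact absurd h2 (not_lt.2 (hfar (s n) h1))

/-- The penalized problem has a sublevel point near which, as soon as it is interior, there are
stationary triples. -/
theorem exists_frequently_penaltyStationary {φ : X → ℝ} (hφ : Continuous φ) {Φ : X → Set Y}
    (hΦ : IsClosed {p : X × Y | p.2 ∈ Φ p.1}) {xbar : X} {ybar : Y} (hbar : ybar ∈ Φ xbar)
    {r L : ℝ} (hr : 0 < r) (hL : 0 ≤ L)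
    (hLip : ∀ z ∈ Metric.closedBall xbar r, ∀ w ∈ Metric.closedBall xbar r,
      φ z - φ w ≤ L * ‖z - w‖) {κ : ℝ} (hκ : 0 < κ) :
    ∃ x ∈ Metric.closedBall xbar r, ∃ y ∈ Metric.closedBall ybar r, y ∈ Φ x ∧
      φ x + 1 / 2 * ‖x - xbar‖ ^ 2 + κ / 2 * ‖y - ybar‖ ^ 2 ≤ φ xbar ∧
      (‖x - xbar‖ < r → ‖y - ybar‖ < r →
        ∃ᶠ p in 𝓝 (x, x, y), PenaltyStationary φ Φ xbar ybar κ (2 * L) p) := by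
  set S : Set (X × X × Y) := (Metric.closedBall xbar r ×ˢ Metric.closedBall xbar r ×ˢ
    Metric.closedBall ybar r) ∩ {p | p.2.2 ∈ Φ p.2.1} with hS
  have hScl : IsClosed {p : X × X × Y | p.2.2 ∈ Φ p.2.1} := hΦ.preimage continuous_snd
  have hScomp : IsCompact S := ((isCompact_closedBall _ _).prod
    ((isCompact_closedBall _ _).prod (isCompact_closedBall _ _))).inter_right hScl
  have hxr : xbar ∈ Metric.closedBall xbar r := Metric.mem_closedBall_self hr.le
  have hbarS : (xbar, xbar, ybar) ∈ S := ⟨⟨hxr, hxr, Metric.mem_closedBall_self hr.le⟩, hbar⟩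
  let G : ℕ → X × X × Y → ℝ := fun j p => φ p.1 + 1 / 2 * ‖p.2.1 - xbar‖ ^ 2 +
    κ / 2 * ‖p.2.2 - ybar‖ ^ 2 + (j + 1 : ℝ) / 2 * ‖p.1 - p.2.1‖ ^ 2
  have hG : ∀ j, Continuous (G j) := fun j => by fun_prop
  choose z hzS hzmin using fun j => hScomp.exists_isMinOn ⟨_, hbarS⟩ (hG j).continuousOn
  have hzle : ∀ j, G j (z j) ≤ φ xbar := fun j => by
    simpa [G] using hzmin j hbarS
  obtain ⟨⟨x', x, y⟩, hmem, s, hs, hlim⟩ := hScomp.tendsto_subseq hzS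
  have hl1 : Tendsto (fun n => (z (s n)).1) atTop (𝓝 x') := (continuous_fst.tendsto _).comp hlim
  have hl2 : Tendsto (fun n => (z (s n)).2.1) atTop (𝓝 x) :=
    ((continuous_fst.comp continuous_snd).tendsto _).comp hlim
  have hl3 : Tendsto (fun n => (z (s n)).2.2) atTop (𝓝 y) :=
    ((continuous_snd.comp continuous_snd).tendsto _).comp hlim
  obtain ⟨B, hB⟩ := ((isCompact_closedBall xbar r).image hφ).bddBelow
  have hBz : ∀ n, B ≤ φ (z n).1 := fun n => hB ⟨_, (hzS n).1.1, rfl⟩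
  have hxx : x' = x := by
    have hup : Tendsto (fun n => 2 * (φ xbar - B) * (1 / ((s n : ℝ) + 1))) atTop (𝓝 0) := by
      simpa using (tendsto_one_div_add_atTop_nhds_zero_nat.comp hs.tendsto_atTop).const_mul
        (2 * (φ xbar - B))
    have hsq : Tendsto (fun n => ‖(z (s n)).1 - (z (s n)).2.1‖ ^ 2) atTop (𝓝 0) := by
      refine squeeze_zero (fun n => by positivity) (fun n => ?_) hup
      rw [mul_one_div, le_div_iff₀ (by positivity)]
      have h1 := hzle (s n)
      have h2 : 0 ≤ κ / 2 * ‖(z (s n)).2.2 - ybar‖ ^ 2 := by positivity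
      simp only [G] at h1
      nlinarith [hBz (s n), sq_nonneg ‖(z (s n)).2.1 - xbar‖]
    have := tendsto_nhds_unique (((hl1.sub hl2).norm).pow 2) hsq
    simpa [sub_eq_zero] using this
  subst hxx
  refine ⟨x', hmem.1.1, y, hmem.1.2.2, hmem.2, ?_, fun hxi hyi => ?_⟩
  · refine le_of_tendsto ((((hφ.tendsto x').comp hl1).add
      ((((hl2.sub_const xbar).norm).pow 2).const_mul (1 / 2))).add
      ((((hl3.sub_const ybar).norm).pow 2).const_mul (κ / 2))) (Eventually.of_forall fun n => ?_)
    have h1 := hzle (s n)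
    have h2 : 0 ≤ ((s n : ℝ) + 1) / 2 * ‖(z (s n)).1 - (z (s n)).2.1‖ ^ 2 := by positivity
    simp only [G] at h1
    simp only [Function.comp_apply]
    linarith
  · refine hlim.frequently (Eventually.frequently ?_)
    have hb1 : ∀ᶠ n in atTop, (z (s n)).1 ∈ Metric.ball xbar r :=
      hl1.eventually (Metric.isOpen_ball.mem_nhds (mem_ball_iff_norm.2 hxi))
    have hb2 : ∀ᶠ n in atTop, (z (s n)).2.1 ∈ Metric.ball xbar r :=
      hl2.eventually (Metric.isOpen_ball.mem_nhds (mem_ball_iff_norm.2 hxi))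
    have hb3 : ∀ᶠ n in atTop, (z (s n)).2.2 ∈ Metric.ball ybar r :=
      hl3.eventually (Metric.isOpen_ball.mem_nhds (mem_ball_iff_norm.2 hyi))
    filter_upwards [hb1, hb2, hb3] with n h1 h2 h3
    simp only [Function.comp_apply]
    have hm := hzmin (s n)
    have hmS := hzS (s n)
    set c : ℝ := (s n : ℝ) + 1 with hc
    have hc0 : 0 < c := by positivity
    generalize z (s n) = p at *
    obtain ⟨p1, p2, p3⟩ := p
    simp only at h1 h2 h3
    have hGs : ∀ q, G (s n) q = φ q.1 + 1 / 2 * ‖q.2.1 - xbar‖ ^ 2 +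
      κ / 2 * ‖q.2.2 - ybar‖ ^ 2 + c / 2 * ‖q.1 - q.2.1‖ ^ 2 := fun q => rfl
    have hm' : ∀ q ∈ S, G (s n) (p1, p2, p3) ≤ G (s n) q := fun q hq => hm hq
    simp only [hGs] at hm'
    refine ⟨hmS.2, -(c • (p1 - p2)), ?_, ?_, ?_⟩
    · refine mem_regularSubdifferential_of_isLocalMin hc0.le ?_
      filter_upwards [Metric.isOpen_ball.mem_nhds h1] with w hw
      have := hm' (w, p2, p3) ⟨⟨Metric.ball_subset_closedBall hw, hmS.1.2⟩, hmS.2⟩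
      simp only at this ⊢
      linarith
    · have h4 := hm' (p2, p2, p3) ⟨⟨hmS.1.2.1, hmS.1.2⟩, hmS.2⟩
      have h5 := hLip p2 hmS.1.2.1 p1 hmS.1.1
      rw [norm_sub_rev] at h5
      simp only [sub_self, norm_zero] at h4
      rw [norm_neg, norm_smul, Real.norm_of_nonneg hc0.le]
      rcases (norm_nonneg (p1 - p2)).eq_or_lt with h0 | h0
      · rw [← h0]; linarith
      · have : (c * ‖p1 - p2‖) * ‖p1 - p2‖ ≤ (2 * L) * ‖p1 - p2‖ := by nlinarith
        exact le_of_mul_le_mul_right this h0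
    · have hkey : -(p2 - xbar) - -(c • (p1 - p2)) = -(p2 - xbar) - c • (p2 - p1) := by
        rw [← neg_sub p1 p2, smul_neg]
      simp only
      rw [hkey]
      refine mem_regularCoderivative_of_isLocalMinOn hc0.le hκ.le hmS.2 ?_
      filter_upwards [(Metric.isOpen_ball.prod Metric.isOpen_ball).mem_nhds
        (show (p2, p3) ∈ _ from ⟨h2, h3⟩)] with q hq hqΦ
      have := hm' (p1, q.1, q.2) ⟨⟨hmS.1.1, Metric.ball_subset_closedBall hq.1,
        Metric.ball_subset_closedBall hq.2⟩, hqΦ⟩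
      simp only at this
      rw [norm_sub_rev p2 p1, norm_sub_rev q.1 p1]
      linarith

/-- Near a local minimizer there are stationary triples whose multiplier is either small or
governed by the distance of the base point to the minimizer. -/
theorem exists_penaltyStationary {φ : X → ℝ} (hφ : Continuous φ) {Φ : X → Set Y}
    (hΦ : IsClosed {p : X × Y | p.2 ∈ Φ p.1}) {xbar : X} {ybar : Y} (hbar : ybar ∈ Φ xbar)
    {r L : ℝ} (hr : 0 < r) (hL : 0 ≤ L)
    (hLip : ∀ z ∈ Metric.closedBall xbar r, ∀ w ∈ Metric.closedBall xbar r,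
      φ z - φ w ≤ L * ‖z - w‖)
    (hmin : ∀ z ∈ Metric.closedBall xbar r, ybar ∈ Φ z → φ xbar ≤ φ z) {ε : ℝ} (hε : 0 < ε) :
    ∃ (κ : ℝ) (x' x : X) (y : Y), 0 < κ ∧
      PenaltyStationary φ Φ xbar ybar κ (2 * L) (x', x, y) ∧
      ‖x' - xbar‖ < ε ∧ ‖x - xbar‖ < ε ∧ ‖y - ybar‖ < ε ∧
      (κ * ‖y - ybar‖ < 1 ∨
        (ybar ∉ Φ x ∧ ybar ∉ Φ x' ∧ y ≠ ybar ∧ φ x - φ xbar < ε * ‖x - xbar‖ ∧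
          κ * ‖y - ybar‖ ^ 2 < (2 * L + 1) * ‖x - xbar‖ ∧ ‖x' - x‖ < ε * ‖x - xbar‖)) := by
  obtain ⟨κ, hκ, hnear⟩ := exists_penalty_forall_near hφ hΦ hmin (lt_min hε hr)
  obtain ⟨a, ha, b, hb, hab, hle, hfreq⟩ :=
    exists_frequently_penaltyStationary hφ hΦ hbar hr hL hLip hκ
  obtain ⟨hax, hby⟩ := hnear a ha b hb hab hle
  have hfr := hfreq (hax.trans_le (min_le_right _ _)) (hby.trans_le (min_le_right _ _))
  have hax := hax.trans_le (min_le_left _ _)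
  have hby := hby.trans_le (min_le_left _ _)
  have e1 : ∀ᶠ p in 𝓝 (a, a, b), ‖p.1 - xbar‖ < ε :=
    (by fun_prop : Continuous fun p : X × X × Y => ‖p.1 - xbar‖).continuousAt.eventually_lt_const
      hax
  have e2 : ∀ᶠ p in 𝓝 (a, a, b), ‖p.2.1 - xbar‖ < ε :=
    (by fun_prop : Continuous fun p : X × X × Y => ‖p.2.1 - xbar‖).continuousAt.eventually_lt_const
      hax
  have e3 : ∀ᶠ p in 𝓝 (a, a, b), ‖p.2.2 - ybar‖ < ε :=
    (by fun_prop : Continuous fun p : X × X × Y => ‖p.2.2 - ybar‖).continuousAt.eventually_lt_const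
      hby
  -- Stationary triples exist only near `(a, a, b)`, so each alternative is stated by open
  -- conditions, verified at that point.
  suffices h : ∀ᶠ p in 𝓝 (a, a, b), κ * ‖p.2.2 - ybar‖ < 1 ∨
        (ybar ∉ Φ p.2.1 ∧ ybar ∉ Φ p.1 ∧ p.2.2 ≠ ybar ∧
          φ p.2.1 - φ xbar < ε * ‖p.2.1 - xbar‖ ∧
          κ * ‖p.2.2 - ybar‖ ^ 2 < (2 * L + 1) * ‖p.2.1 - xbar‖ ∧
          ‖p.1 - p.2.1‖ < ε * ‖p.2.1 - xbar‖) by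
    obtain ⟨⟨x', x, y⟩, h1, ⟨⟨h2, h3⟩, h4⟩, h5⟩ :=
      (hfr.and_eventually (((e1.and e2).and e3).and h)).exists
    exact ⟨κ, x', x, y, hκ, h1, h2, h3, h4, h5⟩
  have hb2 : 0 ≤ κ / 2 * ‖b - ybar‖ ^ 2 := by positivity
  have ha2 : 0 ≤ 1 / 2 * ‖a - xbar‖ ^ 2 := by positivity
  by_cases hyb : b = ybar
  · have hcont : Continuous fun p : X × X × Y => κ * ‖p.2.2 - ybar‖ := by fun_prop
    filter_upwards [hcont.continuousAt.eventually_lt_const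
      (show κ * ‖b - ybar‖ < 1 by simp [hyb])] with p hp using Or.inl hp
  · have hbpos : 0 < ‖b - ybar‖ := norm_pos_iff.2 (sub_ne_zero.2 hyb)
    have hb3 : 0 < κ / 2 * ‖b - ybar‖ ^ 2 := by positivity
    have hinf : ybar ∉ Φ a := fun h => by linarith [hmin a ha h]
    have hapos : 0 < ‖a - xbar‖ :=
      norm_pos_iff.2 (sub_ne_zero.2 fun h => hinf (h ▸ hbar))
    have hopen : IsOpen {x : X | ybar ∉ Φ x} :=
      (hΦ.preimage (by fun_prop : Continuous fun x : X => (x, ybar))).isOpen_compl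
    have c1 : Continuous fun p : X × X × Y => p.2.1 := by fun_prop
    have c2 : Continuous fun p : X × X × Y => p.1 := by fun_prop
    have c3 : Continuous fun p : X × X × Y => p.2.2 := by fun_prop
    have hLa := hLip xbar (Metric.mem_closedBall_self hr.le) a ha
    rw [norm_sub_rev] at hLa
    have f1 := (c1.tendsto (a, a, b)).eventually (hopen.mem_nhds hinf)
    have f2 := (c2.tendsto (a, a, b)).eventually (hopen.mem_nhds hinf)
    have f3 := (c3.tendsto (a, a, b)).eventually_ne hyb
    have f4 := ContinuousAt.eventually_lt
      (f := fun p : X × X × Y => φ p.2.1 - φ xbar) (g := fun p => ε * ‖p.2.1 - xbar‖)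
      (x₀ := (a, a, b)) (by fun_prop) (by fun_prop)
      (show φ a - φ xbar < ε * ‖a - xbar‖ by nlinarith [mul_pos hε hapos])
    have f5 := ContinuousAt.eventually_lt
      (f := fun p : X × X × Y => κ * ‖p.2.2 - ybar‖ ^ 2)
      (g := fun p => (2 * L + 1) * ‖p.2.1 - xbar‖)
      (x₀ := (a, a, b)) (by fun_prop) (by fun_prop)
      -- The sublevel and Lipschitz inequalities give the factor `2 * L`; the extra `1` makes the
      -- inequality strict.
      (show κ * ‖b - ybar‖ ^ 2 < (2 * L + 1) * ‖a - xbar‖ by nlinarith)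
    have f6 := ContinuousAt.eventually_lt
      (f := fun p : X × X × Y => ‖p.1 - p.2.1‖) (g := fun p => ε * ‖p.2.1 - xbar‖)
      (x₀ := (a, a, b)) (by fun_prop) (by fun_prop)
      (show ‖a - a‖ < ε * ‖a - xbar‖ by simpa using mul_pos hε hapos)
    filter_upwards [f1, f2, f3, f4, f5, f6] with p h1 h2 h3 h4 h5 h6
    exact Or.inr ⟨h1, h2, h3, h4, h5, h6⟩

/-- Stationary triples with bounded multipliers yield M-stationarity in the limit. -/
theorem isMStationary_of_penaltyStationary {φ : X → ℝ} (hφ : Continuous φ) {Φ : X → Set Y}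
    {xbar : X} {ybar : Y} (hbar : ybar ∈ Φ xbar) {R M : ℝ} {κ : ℕ → ℝ} {x' x : ℕ → X}
    {y : ℕ → Y} (hst : ∀ n, PenaltyStationary φ Φ xbar ybar (κ n) R (x' n, x n, y n))
    (hx' : Tendsto x' atTop (𝓝 xbar)) (hx : Tendsto x atTop (𝓝 xbar))
    (hy : Tendsto y atTop (𝓝 ybar)) (hM : ∀ n, ‖κ n • (y n - ybar)‖ ≤ M) :
    IsMStationary φ Φ ybar xbar := by
  choose hgr ξ hξ hξR hco using hst
  obtain ⟨⟨ζ, lam⟩, -, s, hs, hlim⟩ :=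
    ((isCompact_closedBall (0 : X) R).prod (isCompact_closedBall (0 : Y) M)).tendsto_subseq
      (x := fun n => (ξ n, κ n • (y n - ybar)))
      (fun n => ⟨mem_closedBall_zero_iff.2 (hξR n), mem_closedBall_zero_iff.2 (hM n)⟩)
  have hζ : Tendsto (fun n => ξ (s n)) atTop (𝓝 ζ) := (continuous_fst.tendsto _).comp hlim
  have hlam : Tendsto (fun n => κ (s n) • (y (s n) - ybar)) atTop (𝓝 lam) :=
    (continuous_snd.tendsto _).comp hlim
  have hxs := hx.comp hs.tendsto_atTop
  have hxs' := hx'.comp hs.tendsto_atTop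
  have hys := hy.comp hs.tendsto_atTop
  have hR : Continuous (WithLp.toLp 2 : X × ℝ → WithLp 2 (X × ℝ)) :=
    WithLp.prod_continuous_toLp 2 X ℝ
  have hY : Continuous (WithLp.toLp 2 : X × Y → WithLp 2 (X × Y)) :=
    WithLp.prod_continuous_toLp 2 X Y
  refine ⟨hbar, lam, Set.mem_add.2 ⟨ζ, ?_, -ζ, ?_, add_neg_cancel ζ⟩⟩
  · refine ⟨le_refl (φ xbar), fun n => WithLp.toLp 2 (x' (s n), φ (x' (s n))),
      fun n => WithLp.toLp 2 (ξ (s n), (-1 : ℝ)), fun n => le_refl (φ (x' (s n))), ?_, ?_,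
      fun n => hξ (s n)⟩
    · exact (hR.tendsto _).comp (hxs'.prodMk_nhds ((hφ.tendsto xbar).comp hxs'))
    · exact (hR.tendsto _).comp (hζ.prodMk_nhds tendsto_const_nhds)
  · refine ⟨hbar, fun n => WithLp.toLp 2 (x (s n), y (s n)),
      fun n => WithLp.toLp 2 (-(x (s n) - xbar) - ξ (s n), -(κ (s n) • (y (s n) - ybar))),
      fun n => hgr (s n), ?_, ?_, fun n => hco (s n)⟩
    · exact (hY.tendsto _).comp (hxs.prodMk_nhds hys)
    · refine (hY.tendsto _).comp (Tendsto.prodMk_nhds ?_ hlam.neg)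
      simpa using ((hxs.sub_const xbar).neg).sub hζ

end Penalization

/-! ### Directions of approach. -/

section Directions

variable {X : Type*} [NormedAddCommGroup X] [InnerProductSpace ℝ X]

/-- Two sequences whose difference is small relative to the distance to the limit approach it from
the same direction. -/
theorem tendsto_direction_of_norm_sub_le {xbar u : X} (hu : ‖u‖ = 1) {x x' : ℕ → X} {δ : ℕ → ℝ}
    (hδ : Tendsto δ atTop (𝓝 0)) (hpos : ∀ n, 0 < ‖x n - xbar‖)
    (hle : ∀ n, ‖x' n - x n‖ ≤ δ n * ‖x n - xbar‖)
    (hx : Tendsto (fun n => ‖x n - xbar‖⁻¹ • (x n - xbar)) atTop (𝓝 u)) :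
    Tendsto (fun n => ‖x' n - xbar‖⁻¹ • (x' n - xbar)) atTop (𝓝 u) := by
  have h1 : Tendsto (fun n => ‖x n - xbar‖⁻¹ • (x' n - x n)) atTop (𝓝 0) := by
    refine squeeze_zero_norm (fun n => ?_) hδ
    rw [norm_smul, norm_inv, norm_norm, inv_mul_le_iff₀ (hpos n), mul_comm]
    exact hle n
  have h2 : Tendsto (fun n => ‖x n - xbar‖⁻¹ • (x' n - xbar)) atTop (𝓝 u) := by
    have := hx.add h1
    rw [add_zero] at this
    refine this.congr fun n => ?_
    rw [← smul_add]
    congr 1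
    abel
  -- Normalizing a vector is unaffected by a positive factor, so `h2` may be normalized again.
  have h3 := (h2.norm.inv₀ (by simp [hu])).smul h2
  rw [hu, inv_one, one_smul] at h3
  refine h3.congr fun n => ?_
  have := (hpos n).ne'
  rw [norm_smul, norm_inv, norm_norm, mul_inv, inv_inv, smul_smul]
  congr 1
  field_simp

end Directions

end VarAnalysis

/-! ### Bounded versus unbounded multipliers. -/

theorem corollary4p4
    {X Y : Type*}
    [NormedAddCommGroup X] [InnerProductSpace ℝ X] [FiniteDimensional ℝ X]
    [NormedAddCommGroup Y] [InnerProductSpace ℝ Y] [FiniteDimensional ℝ Y]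
    (φ : X → ℝ) (hφ : LocallyLipschitz φ)
    (Φ : X → Set Y) (hΦ : IsClosed (VarAnalysis.gph Φ))
    (ybar : Y) (xbar : X) (hmin : VarAnalysis.IsLocalMinimizer φ Φ ybar xbar) :
    VarAnalysis.IsMStationary φ Φ ybar xbar ∨
    ∃ (u : X) (yStar : Y) (x x' η : ℕ → X) (y ys : ℕ → Y),
      VarAnalysis.IsCriticalDirection φ Φ ybar xbar u ∧
      (∀ k, x k ∉ VarAnalysis.inverseMap Φ ybar ∧ x' k ∉ VarAnalysis.inverseMap Φ ybar ∧
        y k ≠ ybar ∧ ys k ≠ 0) ∧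
      Tendsto x atTop (𝓝 xbar) ∧
      Tendsto x' atTop (𝓝 xbar) ∧
      Tendsto y atTop (𝓝 ybar) ∧
      Tendsto (fun k => ‖x k - xbar‖⁻¹ • (x k - xbar)) atTop (𝓝 u) ∧
      Tendsto (fun k => ‖x' k - xbar‖⁻¹ • (x' k - xbar)) atTop (𝓝 u) ∧
      Tendsto (fun k => ‖x k - xbar‖⁻¹ • (y k - ybar)) atTop (𝓝 0) ∧
      Tendsto ys atTop (𝓝 yStar) ∧
      Tendsto (fun k => ‖x k - xbar‖ / ‖y k - ybar‖ * ‖ys k‖) atTop atTop ∧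
      Tendsto η atTop (𝓝 0) ∧
      Tendsto (fun k => ‖y k - ybar‖⁻¹ • (y k - ybar) - ‖ys k‖⁻¹ • ys k) atTop (𝓝 0) ∧
      (∀ k, η k ∈ VarAnalysis.regularSubdifferential φ (x' k) +
        VarAnalysis.regularCoderivative Φ (x k) (y k)
          ((‖x k - xbar‖ / ‖y k - ybar‖) • ys k)) := by
  have hcont : Continuous φ := hφ.continuous
  have hcl : IsClosed {p : X × Y | p.2 ∈ Φ p.1} :=
    hΦ.preimage (WithLp.prod_continuous_toLp 2 X Y)
  have hbar : ybar ∈ Φ xbar := hmin.1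
  obtain ⟨r, L, hr, hL, hLip, hloc⟩ : ∃ r L : ℝ, 0 < r ∧ 0 ≤ L ∧
      (∀ z ∈ Metric.closedBall xbar r, ∀ w ∈ Metric.closedBall xbar r,
        φ z - φ w ≤ L * ‖z - w‖) ∧
      ∀ z ∈ Metric.closedBall xbar r, ybar ∈ Φ z → φ xbar ≤ φ z := by
    obtain ⟨K, t, ht, hK⟩ := hφ xbar
    have hev : ∀ᶠ z in 𝓝 xbar, z ∈ t ∧ (ybar ∈ Φ z → φ xbar ≤ φ z) :=
      (show ∀ᶠ z in 𝓝 xbar, z ∈ t from ht).and (eventually_nhdsWithin_iff.1 hmin.2)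
    obtain ⟨r, hr, hball⟩ := Metric.nhds_basis_closedBall.eventually_iff.1 hev
    refine ⟨r, K, hr, K.2, fun z hz w hw => ?_, fun z hz => (hball hz).2⟩
    have := hK.dist_le_mul z (hball hz).1 w (hball hw).1
    rw [Real.dist_eq, dist_eq_norm] at this
    exact (le_abs_self _).trans this
  choose κ x' x y hκ hst hx'n hxn hyn hdich using fun n : ℕ =>
    VarAnalysis.exists_penaltyStationary hcont hcl hbar hr hL hLip hloc
      (ε := 1 / ((n : ℝ) + 1)) (by positivity)
  have hδ := tendsto_one_div_add_atTop_nhds_zero_nat (𝕜 := ℝ)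
  have hx : Tendsto x atTop (𝓝 xbar) :=
    tendsto_iff_norm_sub_tendsto_zero.2 (squeeze_zero (fun _ => norm_nonneg _)
      (fun n => (hxn n).le) hδ)
  have hx' : Tendsto x' atTop (𝓝 xbar) :=
    tendsto_iff_norm_sub_tendsto_zero.2 (squeeze_zero (fun _ => norm_nonneg _)
      (fun n => (hx'n n).le) hδ)
  have hy : Tendsto y atTop (𝓝 ybar) :=
    tendsto_iff_norm_sub_tendsto_zero.2 (squeeze_zero (fun _ => norm_nonneg _)
      (fun n => (hyn n).le) hδ)
  have hnorm : ∀ n, ‖κ n • (y n - ybar)‖ = κ n * ‖y n - ybar‖ := fun n => by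
    rw [norm_smul, Real.norm_of_nonneg (hκ n).le]
  by_cases htop : Tendsto (fun n => κ n * ‖y n - ybar‖) atTop atTop
  swap
  · left
    rw [tendsto_atTop] at htop
    push Not at htop
    obtain ⟨M, hM⟩ := htop
    obtain ⟨s, hs, hsM⟩ := extraction_of_frequently_atTop hM
    exact VarAnalysis.isMStationary_of_penaltyStationary hcont hbar (M := M)
      (fun n => hst (s n)) (hx'.comp hs.tendsto_atTop) (hx.comp hs.tendsto_atTop)
      (hy.comp hs.tendsto_atTop) (fun n => by rw [hnorm]; exact (hsM n).le)
  right
  have hgood : ∀ᶠ n in atTop, ybar ∉ Φ (x n) ∧ ybar ∉ Φ (x' n) ∧ y n ≠ ybar ∧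
      φ (x n) - φ xbar < 1 / ((n : ℝ) + 1) * ‖x n - xbar‖ ∧
      κ n * ‖y n - ybar‖ ^ 2 < (2 * L + 1) * ‖x n - xbar‖ ∧
      ‖x' n - x n‖ < 1 / ((n : ℝ) + 1) * ‖x n - xbar‖ := by
    filter_upwards [htop.eventually_ge_atTop 1] with n hn
    exact (hdich n).resolve_left (not_lt.2 hn)
  obtain ⟨s₀, hs₀, hgood₀⟩ := extraction_of_eventually_atTop hgood
  have hpos₀ : ∀ n, 0 < ‖x (s₀ n) - xbar‖ := fun n =>
    norm_pos_iff.2 (sub_ne_zero.2 fun h => (hgood₀ n).1 (h ▸ hbar))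
  -- This scaling cancels the factor `‖x n - xbar‖ / ‖y n - ybar‖` of the conclusion and leaves a
  -- bounded sequence.
  let μ : ℕ → Y := fun n => (‖y n - ybar‖ / ‖x n - xbar‖) • κ n • (y n - ybar)
  have hμ : ∀ n, ‖μ n‖ = κ n * ‖y n - ybar‖ ^ 2 / ‖x n - xbar‖ := fun n => by
    rw [norm_smul, hnorm, Real.norm_of_nonneg (by positivity)]
    ring
  obtain ⟨⟨u, yStar⟩, hmem, s₁, hs₁, hlim⟩ :=
    ((isCompact_sphere (0 : X) 1).prod (isCompact_closedBall (0 : Y) (2 * L + 1))).tendsto_subseq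
      (x := fun n => (‖x (s₀ n) - xbar‖⁻¹ • (x (s₀ n) - xbar), μ (s₀ n)))
      (fun n => ⟨by
        rw [mem_sphere_zero_iff_norm, norm_smul, norm_inv, norm_norm,
          inv_mul_cancel₀ (hpos₀ n).ne'], by
        rw [mem_closedBall_zero_iff, hμ, div_le_iff₀ (hpos₀ n)]
        exact (hgood₀ n).2.2.2.2.1.le⟩)
  let s : ℕ → ℕ := fun n => s₀ (s₁ n)
  have hs : Tendsto s atTop atTop := hs₀.tendsto_atTop.comp hs₁.tendsto_atTop
  have hg := fun n => hgood₀ (s₁ n)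
  have hpos : ∀ n, 0 < ‖x (s n) - xbar‖ := fun n => hpos₀ (s₁ n)
  have hypos : ∀ n, 0 < ‖y (s n) - ybar‖ := fun n =>
    norm_pos_iff.2 (sub_ne_zero.2 (hg n).2.2.1)
  have hu : ‖u‖ = 1 := mem_sphere_zero_iff_norm.1 hmem.1
  have hdir : Tendsto (fun n => ‖x (s n) - xbar‖⁻¹ • (x (s n) - xbar)) atTop (𝓝 u) :=
    (continuous_fst.tendsto _).comp hlim
  have hμlim : Tendsto (fun n => μ (s n)) atTop (𝓝 yStar) := (continuous_snd.tendsto _).comp hlim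
  have hδs : Tendsto (fun n => 1 / ((s n : ℝ) + 1)) atTop (𝓝 0) := hδ.comp hs
  have hμpos : ∀ n, 0 < ‖μ (s n)‖ := fun n => by
    rw [hμ]
    exact div_pos (mul_pos (hκ _) (pow_pos (hypos n) 2)) (hpos n)
  have hscale : ∀ n, (‖x (s n) - xbar‖ / ‖y (s n) - ybar‖) • μ (s n) =
      κ (s n) • (y (s n) - ybar) := fun n => by
    have h1 := (hpos n).ne'
    have h2 := (hypos n).ne'
    simp only [μ]
    rw [smul_smul, div_mul_div_cancel₀ h2, div_self h1, one_smul]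
  have hyslope : Tendsto (fun n => ‖x (s n) - xbar‖⁻¹ • (y (s n) - ybar)) atTop (𝓝 0) := by
    refine squeeze_zero_norm (a := fun n => (2 * L + 1) / (κ (s n) * ‖y (s n) - ybar‖))
      (fun n => ?_) ((htop.comp hs).const_div_atTop _)
    have h2 := hypos n
    have h3 := hκ (s n)
    rw [norm_smul, norm_inv, norm_norm, inv_mul_le_iff₀ (hpos n), mul_div_assoc',
      le_div_iff₀ (by positivity)]
    nlinarith [(hg n).2.2.2.2.1]
  have hpt : ∀ n, xbar + ‖x (s n) - xbar‖ • (‖x (s n) - xbar‖⁻¹ • (x (s n) - xbar)) = x (s n) :=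
    fun n => by rw [smul_inv_smul₀ (hpos n).ne', add_sub_cancel]
  have hptY : ∀ n, ybar + ‖x (s n) - xbar‖ • (‖x (s n) - xbar‖⁻¹ • (y (s n) - ybar)) = y (s n) :=
    fun n => by rw [smul_inv_smul₀ (hpos n).ne', add_sub_cancel]
  have hxs : Tendsto (fun n => x (s n)) atTop (𝓝 xbar) := hx.comp hs
  refine ⟨u, yStar, fun n => x (s n), fun n => x' (s n), fun n => -(x (s n) - xbar),
    fun n => y (s n), fun n => μ (s n), ⟨hu, _, _, fun n => ‖x (s n) - xbar‖, hdir, hyslope, hpos,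
      ?_, fun n => ?_, ?_⟩,
    fun n => ⟨(hg n).1, (hg n).2.1, (hg n).2.2.1, norm_pos_iff.1 (hμpos n)⟩,
    hxs, hx'.comp hs, hy.comp hs, hdir, ?_, hyslope, hμlim, ?_, ?_, ?_, fun n => ?_⟩
  · simpa using (hxs.sub_const xbar).norm
  · rw [hpt, hptY]
    exact (hst (s n)).1
  · simp only [hpt]
    have hE : Tendsto (fun n => ((1 / ((s n : ℝ) + 1) : ℝ) : EReal)) atTop (𝓝 ((0 : ℝ) : EReal)) :=
      (continuous_coe_real_ereal.tendsto 0).comp hδs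
    rw [EReal.coe_zero] at hE
    rw [← hE.limsup_eq]
    refine limsup_le_limsup (Eventually.of_forall fun n => ?_)
    refine EReal.coe_le_coe_iff.2 ?_
    rw [div_le_iff₀ (hpos n)]
    exact (hg n).2.2.2.1.le
  · exact VarAnalysis.tendsto_direction_of_norm_sub_le hu hδs hpos
      (fun n => (hg n).2.2.2.2.2.le) hdir
  · refine (htop.comp hs).congr fun n => ?_
    have := congrArg norm (hscale n)
    rw [hnorm, norm_smul, Real.norm_of_nonneg (by positivity)] at this
    exact this.symm
  · simpa using (hxs.sub_const xbar).neg
  -- `μ` is a positive multiple of `y - ybar`, so the difference of unit vectors is identically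
  -- zero.
  · refine tendsto_const_nhds.congr fun n => ?_
    have h1 := (hpos n).ne'
    have h2 := (hypos n).ne'
    have h3 := (hκ (s n)).ne'
    rw [eq_comm, sub_eq_zero, hμ]
    simp only [μ]
    rw [smul_smul, smul_smul]
    congr 1
    field_simp
  · obtain ⟨-, ξ, hξ, -, hco⟩ := hst (s n)
    rw [hscale]
    exact Set.mem_add.2 ⟨ξ, hξ, _, hco, add_sub_cancel _ _⟩
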